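/- Let $(M,\varphi,\xi,\eta,g)$ be a $(2n+1)$-dimensional almost contact complex Riemannian (almost contact B-metric) manifold: $M$ is a smooth (Hausdorff) manifold, $\varphi$ a smooth endomorphism field of $TM$, $\xi$ a smooth vector field, $\eta$ a smooth 1-form and $g$ a pseudo-Riemannian metric of signature $(n+1,n)$ with $$\varphi\xi=0,\quad \varphi^2=-\iota+\eta\otimes\xi,\quad \eta\circ\varphi=0,\quad \eta(\xi)=1,\quad g(\varphi x,\varphi y)=-g(x,y)+\eta(x)\eta(y).$$ Its associated metric is $\tilde g(x,y)=g(x,\varphi y)+\eta(x)\eta(y)$. Suppose it is an $\mathcal F_0$-manifold (cosymplectic), i.e. $F(x,y,z)=g((\nabla_x\varphi)y,z)$ vanishes identically, where $\nabla$ is the Levi-Civita connection of $g$. Let $u,v,w$ be smooth functions on $M$ and let $(\varphi,\bar\xi,\bar\eta,\bar g)$ be obtained by the contact conformal $G$-transformation $$\bar\xi=e^{-w}\xi,\quad \bar\eta=e^{w}\eta,\quad \bar g=e^{2u}\cos 2v\,g+e^{2u}\sin 2v\,\tilde g+\left(e^{2w}-e^{2u}\cos 2v-e^{2u}\sin 2v\right)\eta\otimes\eta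 .$$ For tensors $S,T$ of type $(0,2)$ let $S\odot T$ denote the Kulkarni–Nomizu product $$(S\odot T)(x,y,z,t)=S(y,z)T(x,t)-S(x,z)T(y,t)+T(y,z)S(x,t)-T(x,z)S(y,t).$$ Let $\bar R(x,y,z,t)=\bar g(\bar R(x,y)z,t)$, $\bar R(x,y)z=\bar\nabla_x\bar\nabla_yz-\bar\nabla_y\bar\nabla_xz-\bar\nabla_{[x,y]}z$, be the curvature tensor of the Levi-Civita connection $\bar\nabla$ of $\bar g$. Suppose that $\bar g$ generates an almost Riemann soliton with vertical potential $\bar\vartheta=\bar k\,\bar\xi$, i.e. there are smooth functions $\bar\sigma,\bar k$ on $M$ with $$2\bar R+\bar\sigma\,\bar g\odot\bar g+\bar g\odot\mathcal L_{\bar\vartheta}\bar g=0 .$$ Then $$\bar R=-\left[\tfrac{\bar\sigma}{2}+\bar k\,du(\bar\xi)\right]\bar g\odot\bar g-\bar k\left\{dv(\bar\xi)\,\bar g\odot\tilde{\bar g}-\left[du(\bar\xi)+dv(\bar\xi)\right]\bar g\odot(\bar\eta\otimes\bar\eta)\right\}-\tfrac12\,\bar g\odot\bar h_1-\tfrac12\,\bar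 k\,\bar g\odot\bar h_2,$$ where $\tilde{\bar g}(x,y)=\bar g(x,\varphi y)+\bar\eta(x)\bar\eta(y)$ and $$\bar h_1(x,y)=d\bar k(x)\bar\eta(y)+d\bar k(y)\bar\eta(x),\qquad \bar h_2(x,y)=\bar\eta(x)\,dw(\varphi^2y)+\bar\eta(y)\,dw(\varphi^2x).$$ -/

import Mathlib

open Bundle VectorField
open scoped Manifold ContDiff

noncomputable section

set_option linter.unusedSectionVars false

section SmoothTensors

variable {E : Type*} [NormedAddCommGroup E] [NormedSpace ℝ E]
  {H : Type*} [TopologicalSpace H] (I : ModelWithCorners ℝ E H)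
  {M : Type*} [TopologicalSpace M] [ChartedSpace H M] [IsManifold I ∞ M]

/-- The vector field `X` is smooth. -/
def IsSmoothVectorField (X : Π p : M, TangentSpace I p) : Prop :=
  ContMDiff I I.tangent ∞ (fun p => (⟨p, X p⟩ : TangentBundle I M))

/-- The `1`-form `η` is smooth. -/
def IsSmoothOneForm (η : Π p : M, TangentSpace I p →L[ℝ] ℝ) : Prop :=
  ContMDiff I (I.prod 𝓘(ℝ, E →L[ℝ] ℝ)) ∞
    (fun p => TotalSpace.mk' (E →L[ℝ] ℝ)
      (E := fun p : M => TangentSpace I p →L[ℝ] Bundle.Trivial M ℝ p) p (η p))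

/-- The field of endomorphisms `φ` of the tangent bundle is smooth. -/
def IsSmoothEndomorphism (φ : Π p : M, TangentSpace I p →L[ℝ] TangentSpace I p) : Prop :=
  ContMDiff I (I.prod 𝓘(ℝ, E →L[ℝ] E)) ∞
    (fun p => TotalSpace.mk' (E →L[ℝ] E)
      (E := fun p : M => TangentSpace I p →L[ℝ] TangentSpace I p) p (φ p))

/-- The field of bilinear forms `g` on the tangent spaces is smooth. -/
def IsSmoothBilinear (g : Π p : M, TangentSpace I p →L[ℝ] TangentSpace I p →L[ℝ] ℝ) : Prop :=
  ContMDiff I (I.prod 𝓘(ℝ, E →L[ℝ] E →L[ℝ] ℝ)) ∞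
    (fun p => TotalSpace.mk' (E →L[ℝ] E →L[ℝ] ℝ)
      (E := fun p : M => TangentSpace I p →L[ℝ] TangentSpace I p →L[ℝ] Bundle.Trivial M ℝ p)
      p (g p))

variable {I}

theorem IsSmoothBilinear.comp_endomorphism
    {g : Π p : M, TangentSpace I p →L[ℝ] TangentSpace I p →L[ℝ] ℝ}
    (hg : IsSmoothBilinear I g)
    {φ : Π p : M, TangentSpace I p →L[ℝ] TangentSpace I p}
    (hφ : IsSmoothEndomorphism I φ) :
    IsSmoothBilinear I (fun p => (g p) ∘L (φ p)) := by
  intro p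
  have h1 := (contMDiffAt_hom_bundle _).1 (hg p)
  have h2 := (contMDiffAt_hom_bundle _).1 (hφ p)
  refine (contMDiffAt_hom_bundle _).2 ⟨contMDiffAt_id, ?_⟩
  refine (h1.2.clm_comp h2.2).congr_of_eventuallyEq ?_
  filter_upwards [(trivializationAt E (TangentSpace I)
    p).open_baseSet.mem_nhds (FiberBundle.mem_baseSet_trivializationAt' p)] with q hq
  ext v w
  simp only [ContinuousLinearMap.inCoordinates, ContinuousLinearMap.comp_apply]
  congr 3
  exact ((trivializationAt E (TangentSpace I) p).symmL_continuousLinearMapAt (R := ℝ) hq _).symm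

theorem contMDiffAt_clm_smulRight {V : Type*} [NormedAddCommGroup V] [NormedSpace ℝ V]
    {f : M → E →L[ℝ] ℝ} {g : M → V} {p : M}
    (hf : ContMDiffAt I 𝓘(ℝ, E →L[ℝ] ℝ) ∞ f p) (hg : ContMDiffAt I 𝓘(ℝ, V) ∞ g p) :
    ContMDiffAt I 𝓘(ℝ, E →L[ℝ] V) ∞ (fun q => (f q).smulRight (g q)) p :=
  (ContDiff.smulRight contDiff_fst contDiff_snd : ContDiff ℝ ∞
    (fun x : (E →L[ℝ] ℝ) × V => x.1.smulRight x.2)).comp_contMDiffAt (hf.prodMk_space hg)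

theorem IsSmoothOneForm.smulRight
    {η θ : Π p : M, TangentSpace I p →L[ℝ] ℝ}
    (hη : IsSmoothOneForm I η) (hθ : IsSmoothOneForm I θ) :
    IsSmoothBilinear I (fun p => (η p).smulRight (θ p)) := by
  intro p
  have h1 := (contMDiffAt_hom_bundle _).1 (hη p)
  have h2 := (contMDiffAt_totalSpace ..).1 (hθ p)
  refine (contMDiffAt_hom_bundle _).2 ⟨contMDiffAt_id, ?_⟩
  refine (contMDiffAt_clm_smulRight h1.2 h2.2).congr_of_eventuallyEq ?_
  filter_upwards [(trivializationAt E (TangentSpace I)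
    p).open_baseSet.mem_nhds (FiberBundle.mem_baseSet_trivializationAt' p)] with q hq
  ext v w
  simp only [ContinuousLinearMap.inCoordinates, hom_trivializationAt_apply,
    ContinuousLinearMap.comp_apply, ContinuousLinearMap.smulRight_apply, map_smul]
  have hq' : q ∈ (trivializationAt (E →L[ℝ] ℝ)
      (fun b : M => TangentSpace I b →L[ℝ] Bundle.Trivial M ℝ b) p).baseSet := by
    rw [hom_trivializationAt_baseSet]
    exact ⟨hq, by simp⟩
  simp [Trivialization.coe_linearMapAt_of_mem _ hq', hom_trivializationAt_apply,
    ContinuousLinearMap.inCoordinates]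

theorem IsSmoothBilinear.add {g h : Π p : M, TangentSpace I p →L[ℝ] TangentSpace I p →L[ℝ] ℝ}
    (hg : IsSmoothBilinear I g) (hh : IsSmoothBilinear I h) :
    IsSmoothBilinear I (fun p => g p + h p) :=
  ContMDiff.add_section hg hh

theorem IsSmoothBilinear.smul {f : M → ℝ} (hf : ContMDiff I 𝓘(ℝ) ∞ f)
    {g : Π p : M, TangentSpace I p →L[ℝ] TangentSpace I p →L[ℝ] ℝ}
    (hg : IsSmoothBilinear I g) : IsSmoothBilinear I (fun p => f p • g p) :=
  ContMDiff.smul_section hf hg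

end SmoothTensors

section PseudoRiemannian

variable {E : Type*} [NormedAddCommGroup E] [NormedSpace ℝ E]
  {H : Type*} [TopologicalSpace H] (I : ModelWithCorners ℝ E H)
  (M : Type*) [TopologicalSpace M] [ChartedSpace H M] [IsManifold I ∞ M]

/-- A pseudo-Riemannian metric: a smooth field of nondegenerate symmetric bilinear forms. -/
structure PseudoRiemannianMetric where
  val : Π p : M, TangentSpace I p →L[ℝ] TangentSpace I p →L[ℝ] ℝ
  symm : ∀ (p : M) (x y : TangentSpace I p), val p x y = val p y x
  nondegenerate : ∀ (p : M) (x : TangentSpace I p), (∀ y, val p x y = 0) → x = 0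
  smooth : IsSmoothBilinear I val

variable {I M}

namespace PseudoRiemannianMetric

/-- The function `g(X, Y)` for two vector fields `X`, `Y`. -/
def pair (g : PseudoRiemannianMetric I M) (X Y : Π p : M, TangentSpace I p) : M → ℝ :=
  fun p => g.val p (X p) (Y p)

theorem mdifferentiableAt_pair (g : PseudoRiemannianMetric I M) {X Y : Π p : M, TangentSpace I p}
    {p : M} (hX : MDiffAt (T% X) p) (hY : MDiffAt (T% Y) p) : MDiffAt (g.pair X Y) p := by
  have : MDifferentiableAt I (I.prod 𝓘(ℝ))
      (fun m => TotalSpace.mk' ℝ (E := Bundle.Trivial M ℝ) m (g.val m (X m) (Y m))) p := by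
    apply MDifferentiableAt.clm_bundle_apply₂ (F₁ := E) (F₂ := E)
    · exact (g.smooth p).mdifferentiableAt (by simp)
    · exact hX
    · exact hY
  simp only [mdifferentiableAt_totalSpace] at this
  exact this.2

/-- The right hand side of the Koszul formula for `2 g(∇_X Y, Z)`. -/
def koszul (g : PseudoRiemannianMetric I M) (Y X Z : Π p : M, TangentSpace I p) (p : M) : ℝ :=
  mvfderiv I (g.pair Y Z) p (X p) + mvfderiv I (g.pair X Z) p (Y p)
    - mvfderiv I (g.pair X Y) p (Z p)
    + g.val p (mlieBracket I X Y p) (Z p) - g.val p (mlieBracket I X Z p) (Y p)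
    - g.val p (mlieBracket I Y Z p) (X p)

theorem pair_smul_left (g : PseudoRiemannianMetric I M) (f : M → ℝ)
    (X Y : Π p : M, TangentSpace I p) : g.pair (f • X) Y = f * g.pair X Y := by
  ext p; simp [pair]

theorem pair_smul_right (g : PseudoRiemannianMetric I M) (f : M → ℝ)
    (X Y : Π p : M, TangentSpace I p) : g.pair X (f • Y) = f * g.pair X Y := by
  ext p; simp [pair]

theorem pair_add_left (g : PseudoRiemannianMetric I M)
    (X X' Y : Π p : M, TangentSpace I p) : g.pair (X + X') Y = g.pair X Y + g.pair X' Y := by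
  ext p; simp [pair]

theorem pair_add_right (g : PseudoRiemannianMetric I M)
    (X Y Y' : Π p : M, TangentSpace I p) : g.pair X (Y + Y') = g.pair X Y + g.pair X Y' := by
  ext p; simp [pair]

variable [FiniteDimensional ℝ E] [CompleteSpace E]

theorem koszul_tensorial_left (g : PseudoRiemannianMetric I M) {Y Z : Π p : M, TangentSpace I p}
    {p : M} (hY : MDiffAt (T% Y) p) (hZ : MDiffAt (T% Z) p) :
    TensorialAt I E (fun X => g.koszul Y X Z p) p where
  smul {f X} hf hX := by
    simp only [koszul, pair_smul_left, mvfderiv_mul hf (g.mdifferentiableAt_pair hX hY),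
      mvfderiv_mul hf (g.mdifferentiableAt_pair hX hZ), mlieBracket_smul_left hf hX]
    simp [pair]
    rw [g.symm p (X p) (Y p), g.symm p (X p) (Z p)]
    ring
  add {X X'} hX hX' := by
    simp only [koszul, pair_add_left, mvfderiv_add (g.mdifferentiableAt_pair hX hY)
      (g.mdifferentiableAt_pair hX' hY),
      mvfderiv_add (g.mdifferentiableAt_pair hX hZ) (g.mdifferentiableAt_pair hX' hZ),
      mlieBracket_add_left hX hX']
    simp
    ring

theorem koszul_tensorial_right (g : PseudoRiemannianMetric I M) {Y X : Π p : M, TangentSpace I p}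
    {p : M} (hY : MDiffAt (T% Y) p) (hX : MDiffAt (T% X) p) :
    TensorialAt I E (fun Z => g.koszul Y X Z p) p where
  smul {f Z} hf hZ := by
    simp only [koszul, pair_smul_right, mvfderiv_mul hf (g.mdifferentiableAt_pair hX hZ),
      mvfderiv_mul hf (g.mdifferentiableAt_pair hY hZ), mlieBracket_smul_right hf hZ]
    simp [pair]
    rw [g.symm p (Z p) (Y p), g.symm p (Z p) (X p)]
    ring
  add {Z Z'} hZ hZ' := by
    simp only [koszul, pair_add_right, mvfderiv_add (g.mdifferentiableAt_pair hX hZ)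
      (g.mdifferentiableAt_pair hX hZ'),
      mvfderiv_add (g.mdifferentiableAt_pair hY hZ) (g.mdifferentiableAt_pair hY hZ'),
      mlieBracket_add_right hZ hZ']
    simp
    ring

theorem finrank_dual (p : M) : Module.finrank ℝ (TangentSpace I p) =
    Module.finrank ℝ (TangentSpace I p →L[ℝ] ℝ) := by
  change Module.finrank ℝ E = Module.finrank ℝ (E →L[ℝ] ℝ)
  rw [← (LinearMap.toContinuousLinearMap (𝕜 := ℝ) (E := E) (F' := ℝ)).finrank_eq]
  exact (Subspace.dual_finrank_eq (K := ℝ) (V := E)).symm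

/-- The musical isomorphism `x ↦ g(x, ·)`. -/
def flat (g : PseudoRiemannianMetric I M) (p : M) :
    TangentSpace I p ≃ₗ[ℝ] (TangentSpace I p →L[ℝ] ℝ) :=
  haveI : FiniteDimensional ℝ (TangentSpace I p) := inferInstanceAs (FiniteDimensional ℝ E)
  haveI : FiniteDimensional ℝ (TangentSpace I p →L[ℝ] ℝ) :=
    inferInstanceAs (FiniteDimensional ℝ (E →L[ℝ] ℝ))
  LinearMap.linearEquivOfInjective (g.val p).toLinearMap
    ((injective_iff_map_eq_zero _).2 fun x hx =>
      g.nondegenerate p x fun y => by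
        have := congrArg (fun f : TangentSpace I p →L[ℝ] ℝ => f y) hx
        simpa using this)
    (finrank_dual p)

theorem flat_symm_apply (g : PseudoRiemannianMetric I M) (p : M)
    (α : TangentSpace I p →L[ℝ] ℝ) (y : TangentSpace I p) :
    g.val p ((g.flat p).symm α) y = α y := by
  have h : g.flat p ((g.flat p).symm α) = α := (g.flat p).apply_symm_apply α
  have h' : g.flat p ((g.flat p).symm α) = g.val p ((g.flat p).symm α) := rfl
  rw [← h', h]

open Classical in
/-- The Levi-Civita covariant derivative as a bare function, given by the Koszul formula; it is
set to `0` at the points where the differentiated vector field is not differentiable. -/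
def leviCivitaAux (g : PseudoRiemannianMetric I M) (Y : Π p : M, TangentSpace I p) (p : M) :
    TangentSpace I p →L[ℝ] TangentSpace I p :=
  haveI : FiniteDimensional ℝ (TangentSpace I p) := inferInstanceAs (FiniteDimensional ℝ E)
  haveI : T2Space (TangentSpace I p) := inferInstanceAs (T2Space E)
  if hY : MDiffAt (T% Y) p then
    (1 / 2 : ℝ) • LinearMap.toContinuousLinearMap ((g.flat p).symm.toLinearMap ∘ₗ
      (TensorialAt.mkHom₂ (fun X Z => g.koszul Y X Z p) p
        (fun _ hZ => g.koszul_tensorial_left hY hZ)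
        (fun _ hX => g.koszul_tensorial_right hY hX)).toLinearMap)
  else 0

/-- The Koszul formula. -/
theorem leviCivitaAux_apply (g : PseudoRiemannianMetric I M) {X Y Z : Π p : M, TangentSpace I p}
    {p : M} (hX : MDiffAt (T% X) p) (hY : MDiffAt (T% Y) p) (hZ : MDiffAt (T% Z) p) :
    2 * g.val p (g.leviCivitaAux Y p (X p)) (Z p) = g.koszul Y X Z p := by
  have h := TensorialAt.mkHom₂_apply (Φ := fun X Z => g.koszul Y X Z p)
    (fun _ hZ => g.koszul_tensorial_left hY hZ)
    (fun _ hX => g.koszul_tensorial_right hY hX) hX hZ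
  simp [leviCivitaAux, hY, flat_symm_apply, h]

theorem ext_of_pair (g : PseudoRiemannianMetric I M) {p : M} {x y : TangentSpace I p}
    (h : ∀ Z : Π p : M, TangentSpace I p, MDiffAt (T% Z) p →
      g.val p x (Z p) = g.val p y (Z p)) : x = y := by
  refine sub_eq_zero.1 (g.nondegenerate p _ fun z => ?_)
  have := h (FiberBundle.extend E z) (FiberBundle.mdifferentiableAt_extend ..)
  simpa [sub_eq_zero] using this

theorem leviCivitaAux_isCovariantDerivativeOn (g : PseudoRiemannianMetric I M) :
    IsCovariantDerivativeOn E g.leviCivitaAux where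
  add {Y Y' p} hY hY' _ := by
    ext x
    refine g.ext_of_pair fun Z hZ => ?_
    have hx : x = FiberBundle.extend E x p := by simp
    have hX := FiberBundle.mdifferentiableAt_extend I E x
    have e1 := g.leviCivitaAux_apply hX (mdifferentiableAt_add_section hY hY') hZ
    have e2 := g.leviCivitaAux_apply hX hY hZ
    have e3 := g.leviCivitaAux_apply hX hY' hZ
    have e4 : g.koszul (Y + Y') (FiberBundle.extend E x) Z p =
        g.koszul Y (FiberBundle.extend E x) Z p + g.koszul Y' (FiberBundle.extend E x) Z p := by
      simp only [koszul, pair_add_left, pair_add_right,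
        mvfderiv_add (g.mdifferentiableAt_pair hX hY) (g.mdifferentiableAt_pair hX hY'),
        mvfderiv_add (g.mdifferentiableAt_pair hY hZ) (g.mdifferentiableAt_pair hY' hZ),
        mlieBracket_add_left hY hY', mlieBracket_add_right hY hY']
      simp
      ring
    rw [← hx] at e1 e2 e3
    change 2 * g.val p (g.leviCivitaAux (Y + Y') p x) (Z p) = _ at e1
    simp only [add_apply, map_add]
    linarith
  leibniz {Y f p} hY hf _ := by
    ext x
    refine g.ext_of_pair fun Z hZ => ?_
    have hx : x = FiberBundle.extend E x p := by simp
    have hX := FiberBundle.mdifferentiableAt_extend I E x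
    have e1 := g.leviCivitaAux_apply hX (hf.smul_section hY) hZ
    have e2 := g.leviCivitaAux_apply hX hY hZ
    have e4 : g.koszul (f • Y) (FiberBundle.extend E x) Z p =
        f p * g.koszul Y (FiberBundle.extend E x) Z p + 2 * mvfderiv I f p x * g.val p (Y p) (Z p) := by
      simp only [koszul, pair_smul_left, pair_smul_right,
        mvfderiv_mul hf (g.mdifferentiableAt_pair hX hY),
        mvfderiv_mul hf (g.mdifferentiableAt_pair hY hZ),
        mlieBracket_smul_left hf hY, mlieBracket_smul_right hf hY]
      simp [pair]
      rw [g.symm p x (Y p)]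
      ring
    rw [← hx] at e1 e2
    change 2 * g.val p (g.leviCivitaAux (f • Y) p x) (Z p) = _ at e1
    simp
    linear_combination e1 / 2 + e4 / 2 - f p / 2 * e2

/-- The Levi-Civita connection of a pseudo-Riemannian metric. -/
def leviCivita (g : PseudoRiemannianMetric I M) :
    CovariantDerivative I E (TangentSpace I : M → Type _) :=
  ⟨g.leviCivitaAux, g.leviCivitaAux_isCovariantDerivativeOn⟩

theorem leviCivita_torsion (g : PseudoRiemannianMetric I M) : g.leviCivita.torsion = 0 := by
  refine (CovariantDerivative.torsion_eq_zero_iff _).2 fun {X Y p} hX hY => ?_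
  refine g.ext_of_pair fun Z hZ => ?_
  have e1 := g.leviCivitaAux_apply hX hY hZ
  have e2 := g.leviCivitaAux_apply hY hX hZ
  have e3 : g.koszul Y X Z p - g.koszul X Y Z p = 2 * g.val p (mlieBracket I X Y p) (Z p) := by
    have : g.pair Y X = g.pair X Y := funext fun q => g.symm q _ _
    simp only [koszul, this, mlieBracket_swap_apply (V := Y) (W := X)]
    simp
    ring
  change g.val p (g.leviCivitaAux Y p (X p) - g.leviCivitaAux X p (Y p)) (Z p) = _
  simp
  linarith

theorem leviCivita_metric (g : PseudoRiemannianMetric I M) {X Y Z : Π p : M, TangentSpace I p}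
    {p : M} (hX : MDiffAt (T% X) p) (hY : MDiffAt (T% Y) p) (hZ : MDiffAt (T% Z) p) :
    mvfderiv I (g.pair Y Z) p (X p) =
      g.val p (g.leviCivita Y p (X p)) (Z p) + g.val p (Y p) (g.leviCivita Z p (X p)) := by
  have e1 := g.leviCivitaAux_apply hX hY hZ
  have e2 := g.leviCivitaAux_apply hX hZ hY
  have e3 : g.koszul Y X Z p + g.koszul Z X Y p = 2 * mvfderiv I (g.pair Y Z) p (X p) := by
    have : g.pair Z Y = g.pair Y Z := funext fun q => g.symm q _ _
    simp only [koszul, this, mlieBracket_swap_apply (V := Z) (W := Y)]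
    simp
    ring
  rw [g.symm p (Y p)]
  change _ = g.val p (g.leviCivitaAux Y p (X p)) (Z p) + g.val p (g.leviCivitaAux Z p (X p)) (Y p)
  linarith

/-- The curvature `R(X, Y)Z = ∇_X ∇_Y Z - ∇_Y ∇_X Z - ∇_[X, Y] Z`. -/
def curvature (g : PseudoRiemannianMetric I M) (X Y Z : Π p : M, TangentSpace I p) :
    Π p : M, TangentSpace I p := fun p =>
  g.leviCivita (fun q => g.leviCivita Z q (Y q)) p (X p)
    - g.leviCivita (fun q => g.leviCivita Z q (X q)) p (Y p)
    - g.leviCivita Z p (mlieBracket I X Y p)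

/-- The curvature tensor of type `(0, 4)`, `R(X, Y, Z, W) = g(R(X, Y)Z, W)`. -/
def curvature4 (g : PseudoRiemannianMetric I M) (X Y Z W : Π p : M, TangentSpace I p) : M → ℝ :=
  g.pair (g.curvature X Y Z) W

/-- The Lie derivative of the metric,
`(L_V g)(X, Y) = V(g(X, Y)) - g([V, X], Y) - g(X, [V, Y])`. -/
def lieDerivative (g : PseudoRiemannianMetric I M) (V X Y : Π p : M, TangentSpace I p) : M → ℝ :=
  fun p => mvfderiv I (g.pair X Y) p (V p)
    - g.val p (mlieBracket I V X p) (Y p) - g.val p (X p) (mlieBracket I V Y p)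

end PseudoRiemannianMetric

/-- The Kulkarni–Nomizu product of two tensor fields of type `(0, 2)`, both viewed as maps that
take two vector fields to a function. -/
def kulkarniNomizu (S T : (Π p : M, TangentSpace I p) → (Π p : M, TangentSpace I p) → M → ℝ)
    (X Y Z W : Π p : M, TangentSpace I p) : M → ℝ :=
  S Y Z * T X W - S X Z * T Y W + T Y Z * S X W - T X Z * S Y W

/-- The derivative `df(X)` of the function `f` along the vector field `X`. -/
def derivAlong (f : M → ℝ) (X : Π p : M, TangentSpace I p) : M → ℝ :=
  fun p => mvfderiv I f p (X p)

/-- `(g, V, σ)` is an almost Riemann soliton: `V` is a smooth vector field, `σ` is a smooth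
function, and `2 R + σ g ⊛ g + g ⊛ L_V g = 0`, where `⊛` is the Kulkarni–Nomizu product. -/
structure IsAlmostRiemannSoliton [FiniteDimensional ℝ E] [CompleteSpace E]
    (g : PseudoRiemannianMetric I M)
    (V : Π p : M, TangentSpace I p) (σ : M → ℝ) : Prop where
  smooth_potential : IsSmoothVectorField I V
  smooth_function : ContMDiff I 𝓘(ℝ) ∞ σ
  equation : ∀ X Y Z W : Π p : M, TangentSpace I p,
    IsSmoothVectorField I X → IsSmoothVectorField I Y →
    IsSmoothVectorField I Z → IsSmoothVectorField I W →
    2 * g.curvature4 X Y Z W + σ * kulkarniNomizu g.pair g.pair X Y Z W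
      + kulkarniNomizu g.pair (g.lieDerivative V) X Y Z W = 0

end PseudoRiemannian

section AccR

/-- The endomorphism `x ↦ a x + b φ x + (c - a) η(x) ξ`. -/
def contactMap {V : Type*} [AddCommGroup V] [Module ℝ V] (φ : V →ₗ[ℝ] V) (ξ : V) (η : V →ₗ[ℝ] ℝ)
    (a b c : ℝ) : V →ₗ[ℝ] V :=
  a • LinearMap.id + b • φ + (c - a) • η.smulRight ξ

theorem contactMap_comp {V : Type*} [AddCommGroup V] [Module ℝ V] {φ : V →ₗ[ℝ] V} {ξ : V}
    {η : V →ₗ[ℝ] ℝ} (h1 : φ ξ = 0) (h2 : ∀ x, φ (φ x) = -x + η x • ξ) (h3 : ∀ x, η (φ x) = 0)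
    (h4 : η ξ = 1) (a b c a' b' c' : ℝ) :
    contactMap φ ξ η a b c ∘ₗ contactMap φ ξ η a' b' c' =
      contactMap φ ξ η (a * a' - b * b') (a * b' + b * a') (c * c') := by
  ext x
  simp [contactMap, h1, h2, h3, h4]
  module

theorem contactMap_one {V : Type*} [AddCommGroup V] [Module ℝ V] (φ : V →ₗ[ℝ] V) (ξ : V)
    (η : V →ₗ[ℝ] ℝ) : contactMap φ ξ η 1 0 1 = LinearMap.id := by
  ext x
  simp [contactMap]

variable (n : ℕ) (M : Type*) [TopologicalSpace M]
  [ChartedSpace (EuclideanSpace ℝ (Fin (2 * n + 1))) M] [IsManifold (𝓡 (2 * n + 1)) ∞ M]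

/-- An almost contact complex Riemannian structure (almost contact B-metric structure)
`(φ, ξ, η, g)` on a manifold of dimension `2n + 1`. -/
structure AccRStructure where
  φ : Π p : M, TangentSpace (𝓡 (2 * n + 1)) p →L[ℝ] TangentSpace (𝓡 (2 * n + 1)) p
  ξ : Π p : M, TangentSpace (𝓡 (2 * n + 1)) p
  η : Π p : M, TangentSpace (𝓡 (2 * n + 1)) p →L[ℝ] ℝ
  g : PseudoRiemannianMetric (𝓡 (2 * n + 1)) M
  smooth_φ : IsSmoothEndomorphism (𝓡 (2 * n + 1)) φ
  smooth_ξ : IsSmoothVectorField (𝓡 (2 * n + 1)) ξ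
  smooth_η : IsSmoothOneForm (𝓡 (2 * n + 1)) η
  φ_ξ : ∀ p, φ p (ξ p) = 0
  φ_φ : ∀ p x, φ p (φ p x) = -x + η p x • ξ p
  η_φ : ∀ p x, η p (φ p x) = 0
  η_ξ : ∀ p, η p (ξ p) = 1
  g_φ_φ : ∀ p x y, g.val p (φ p x) (φ p y) = -g.val p x y + η p x * η p y
  /-- The metric has signature `(n + 1, n)`. -/
  signature : ∀ p, ∃ b : Module.Basis (Fin (n + 1) ⊕ Fin n) ℝ (TangentSpace (𝓡 (2 * n + 1)) p),
    ∀ i j, g.val p (b i) (b j) = if i = j then Sum.elim (fun _ => 1) (fun _ => -1) i else 0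

variable {n M}

namespace AccRStructure

variable (A : AccRStructure n M)

theorem g_ξ (p : M) (x : TangentSpace (𝓡 (2 * n + 1)) p) : A.g.val p x (A.ξ p) = A.η p x := by
  have := A.g_φ_φ p x (A.ξ p)
  simp [A.φ_ξ, A.η_ξ] at this
  linarith

theorem g_φ_left (p : M) (x y : TangentSpace (𝓡 (2 * n + 1)) p) :
    A.g.val p (A.φ p x) y = A.g.val p x (A.φ p y) := by
  have := A.g_φ_φ p x (A.φ p y)
  simp [A.φ_φ, A.η_φ, A.g_ξ] at this
  linarith

/-- The associated B-metric at a point, as a bilinear form; see `associated_apply`. -/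
def associated (p : M) : TangentSpace (𝓡 (2 * n + 1)) p →L[ℝ]
    TangentSpace (𝓡 (2 * n + 1)) p →L[ℝ] ℝ :=
  A.g.val p ∘L A.φ p + (A.η p).smulRight (A.η p)

theorem associated_apply (p : M) (x y : TangentSpace (𝓡 (2 * n + 1)) p) :
    A.associated p x y = A.g.val p x (A.φ p y) + A.η p x * A.η p y := by
  simp [associated, A.g_φ_left]

/-- The vector field `φX`, for a vector field `X`. -/
def phi (X : Π p : M, TangentSpace (𝓡 (2 * n + 1)) p) : Π p : M, TangentSpace (𝓡 (2 * n + 1)) p :=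
  fun p => A.φ p (X p)

/-- The function `η(X)`, for a vector field `X`. -/
def eta (X : Π p : M, TangentSpace (𝓡 (2 * n + 1)) p) : M → ℝ := fun p => A.η p (X p)

/-- The associated B-metric `g(X, φY) + η(X) η(Y)` on vector fields. -/
def gTilde (X Y : Π p : M, TangentSpace (𝓡 (2 * n + 1)) p) : M → ℝ :=
  fun p => A.associated p (X p) (Y p)

/-- The tensor field `η ⊗ η` on vector fields. -/
def etaSq (X Y : Π p : M, TangentSpace (𝓡 (2 * n + 1)) p) : M → ℝ := A.eta X * A.eta Y

/-- The fundamental tensor `F(X, Y, Z) = g((∇_X φ)Y, Z)`. -/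
def F (X Y Z : Π p : M, TangentSpace (𝓡 (2 * n + 1)) p) : M → ℝ := fun p =>
  A.g.val p (A.g.leviCivita (A.phi Y) p (X p) - A.φ p (A.g.leviCivita Y p (X p))) (Z p)

/-- The cosymplectic class `𝓕₀`: the tensor `F` vanishes. -/
def IsCosymplectic : Prop := ∀ X Y Z : Π p : M, TangentSpace (𝓡 (2 * n + 1)) p,
  IsSmoothVectorField (𝓡 (2 * n + 1)) X → IsSmoothVectorField (𝓡 (2 * n + 1)) Y →
  IsSmoothVectorField (𝓡 (2 * n + 1)) Z → A.F X Y Z = 0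

variable (u v w : C^∞⟮𝓡 (2 * n + 1), M; ℝ⟯)

/-- The bilinear form
`e^{2u} cos 2v g + e^{2u} sin 2v g̃ + (e^{2w} - e^{2u} cos 2v - e^{2u} sin 2v) η ⊗ η`. -/
def transformedForm (p : M) : TangentSpace (𝓡 (2 * n + 1)) p →L[ℝ]
    TangentSpace (𝓡 (2 * n + 1)) p →L[ℝ] ℝ :=
  (Real.exp (2 * u p) * Real.cos (2 * v p)) • A.g.val p
    + (Real.exp (2 * u p) * Real.sin (2 * v p)) • A.associated p
    + (Real.exp (2 * w p) - Real.exp (2 * u p) * Real.cos (2 * v p)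
        - Real.exp (2 * u p) * Real.sin (2 * v p)) • (A.η p).smulRight (A.η p)

theorem transformedForm_apply (p : M) (x y : TangentSpace (𝓡 (2 * n + 1)) p) :
    A.transformedForm u v w p x y = A.g.val p
      (contactMap (A.φ p).toLinearMap (A.ξ p) (A.η p).toLinearMap
        (Real.exp (u p) * Real.cos (v p)) (Real.exp (u p) * Real.sin (v p)) (Real.exp (w p)) x)
      (contactMap (A.φ p).toLinearMap (A.ξ p) (A.η p).toLinearMap
        (Real.exp (u p) * Real.cos (v p)) (Real.exp (u p) * Real.sin (v p))
        (Real.exp (w p)) y) := by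
  have h1 : ∀ z, A.g.val p (A.ξ p) z = A.η p z := fun z => by rw [A.g.symm, A.g_ξ]
  have h2 : ∀ t : ℝ, Real.exp (2 * t) = Real.exp t ^ 2 := fun t => by
    rw [two_mul, Real.exp_add, sq]
  simp [transformedForm, contactMap, associated_apply, h1, h2, A.g_ξ, A.g_φ_left, A.η_φ,
    A.η_ξ, A.φ_ξ, A.φ_φ, Real.cos_two_mul', Real.sin_two_mul]
  ring

/-- The endomorphism of the previous lemma as an equivalence. -/
def contactEquiv (p : M) :
    TangentSpace (𝓡 (2 * n + 1)) p ≃ₗ[ℝ] TangentSpace (𝓡 (2 * n + 1)) p :=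
  LinearEquiv.ofLinearMap
    (contactMap (A.φ p).toLinearMap (A.ξ p) (A.η p).toLinearMap
      (Real.exp (u p) * Real.cos (v p)) (Real.exp (u p) * Real.sin (v p)) (Real.exp (w p)))
    (contactMap (A.φ p).toLinearMap (A.ξ p) (A.η p).toLinearMap
      (Real.exp (-u p) * Real.cos (v p)) (-(Real.exp (-u p) * Real.sin (v p)))
      (Real.exp (-w p)))
    (by
      rw [contactMap_comp (A.φ_ξ p) (A.φ_φ p) (A.η_φ p) (A.η_ξ p), ← contactMap_one]
      have h : ∀ t : ℝ, Real.exp t * Real.exp (-t) = 1 := fun t => by simp [← Real.exp_add]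
      congr 1
      · linear_combination (h (u p)) * (Real.cos (v p) ^ 2 + Real.sin (v p) ^ 2)
          + Real.sin_sq_add_cos_sq (v p)
      · ring
      · exact h _)
    (by
      rw [contactMap_comp (A.φ_ξ p) (A.φ_φ p) (A.η_φ p) (A.η_ξ p), ← contactMap_one]
      have h : ∀ t : ℝ, Real.exp t * Real.exp (-t) = 1 := fun t => by simp [← Real.exp_add]
      congr 1
      · linear_combination (h (u p)) * (Real.cos (v p) ^ 2 + Real.sin (v p) ^ 2)
          + Real.sin_sq_add_cos_sq (v p)
      · ring
      · rw [mul_comm]; exact h _)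

theorem transformedForm_apply' (p : M) (x y : TangentSpace (𝓡 (2 * n + 1)) p) :
    A.transformedForm u v w p x y =
      A.g.val p (A.contactEquiv u v w p x) (A.contactEquiv u v w p y) :=
  A.transformedForm_apply u v w p x y

theorem smooth_transformedForm :
    IsSmoothBilinear (𝓡 (2 * n + 1)) (A.transformedForm u v w) := by
  have h2 : ∀ f : C^∞⟮𝓡 (2 * n + 1), M; ℝ⟯,
      ContMDiff (𝓡 (2 * n + 1)) 𝓘(ℝ) ∞ (fun p => 2 * f p) := fun f =>
    contMDiff_const.mul f.contMDiff
  have he : ∀ f : C^∞⟮𝓡 (2 * n + 1), M; ℝ⟯,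
      ContMDiff (𝓡 (2 * n + 1)) 𝓘(ℝ) ∞ (fun p => Real.exp (2 * f p)) := fun f =>
    Real.contDiff_exp.comp_contMDiff (h2 f)
  have hc := (he u).mul (Real.contDiff_cos.comp_contMDiff (h2 v))
  have hs := (he u).mul (Real.contDiff_sin.comp_contMDiff (h2 v))
  have hη := A.smooth_η.smulRight A.smooth_η
  exact ((A.g.smooth.smul hc).add ((((A.g.smooth.comp_endomorphism A.smooth_φ).add hη)).smul
    hs)).add (hη.smul (((he w).sub hc).sub hs))

/-- The contact conformal `G`-transformation determined by the functions `u`, `v`, `w`. -/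
def gTransform : AccRStructure n M where
  φ := A.φ
  ξ := fun p => Real.exp (-w p) • A.ξ p
  η := fun p => Real.exp (w p) • A.η p
  g :=
    { val := A.transformedForm u v w
      symm := fun p x y => by rw [transformedForm_apply', transformedForm_apply', A.g.symm]
      nondegenerate := fun p x h => by
        have : A.contactEquiv u v w p x = 0 := A.g.nondegenerate p _ fun y => by
          have := h ((A.contactEquiv u v w p).symm y)
          rwa [transformedForm_apply', LinearEquiv.apply_symm_apply] at this
        simpa using this
      smooth := A.smooth_transformedForm u v w }
  smooth_φ := A.smooth_φ
  smooth_ξ :=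
    ContMDiff.smul_section (Real.contDiff_exp.comp_contMDiff (w.contMDiff.neg)) A.smooth_ξ
  smooth_η :=
    ContMDiff.smul_section (Real.contDiff_exp.comp_contMDiff w.contMDiff) A.smooth_η
  φ_ξ := fun p => by simp [A.φ_ξ]
  φ_φ := fun p x => by
    simp [A.φ_φ, smul_smul, mul_right_comm, ← Real.exp_add]
  η_φ := fun p x => by simp [A.η_φ]
  η_ξ := fun p => by simp [A.η_ξ, ← Real.exp_add]
  g_φ_φ := fun p x y => by
    have h2 : ∀ t : ℝ, Real.exp (2 * t) = Real.exp t ^ 2 := fun t => by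
      rw [two_mul, Real.exp_add, sq]
    simp [transformedForm, associated_apply, A.g_φ_φ, A.η_φ, A.φ_φ, A.φ_ξ, A.g_φ_left, h2]
    ring
  signature := fun p => by
    obtain ⟨b, hb⟩ := A.signature p
    refine ⟨b.map (A.contactEquiv u v w p).symm, fun i j => ?_⟩
    rw [← hb, transformedForm_apply']
    simp

/-- The tensor field `h₁(X, Y) = dk(X) η(Y) + dk(Y) η(X)`. -/
def hOne (k : M → ℝ) (X Y : Π p : M, TangentSpace (𝓡 (2 * n + 1)) p) : M → ℝ :=
  derivAlong k X * A.eta Y + derivAlong k Y * A.eta X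

/-- The tensor field `h₂(X, Y) = η(X) dw(φ²Y) + η(Y) dw(φ²X)`. -/
def hTwo (w : M → ℝ) (X Y : Π p : M, TangentSpace (𝓡 (2 * n + 1)) p) : M → ℝ :=
  A.eta X * derivAlong w (A.phi (A.phi Y)) + A.eta Y * derivAlong w (A.phi (A.phi X))

end AccRStructure

end AccR

end

/-! ### Smooth fields and a chain rule. -/

section SmoothTensors

variable {E : Type*} [NormedAddCommGroup E] [NormedSpace ℝ E]
  {H : Type*} [TopologicalSpace H] {I : ModelWithCorners ℝ E H}
  {M : Type*} [TopologicalSpace M] [ChartedSpace H M] [IsManifold I ∞ M]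

/-! The soliton equation is affine in the curvature, so it can be solved for `R̄`; the curvature of
`ḡ` is never computed. All that has to be found is the Lie derivative of `ḡ` along `k ξ̄ = k e^{-w}
ξ`. The class `𝓕₀` means `∇φ = 0`. Applied to `φξ = 0` this gives `φ(∇_X ξ) = 0`, and `g(ξ, ξ) = 1`
gives `η(∇_X ξ) = 0`; hence `∇ξ = 0` (`leviCivita_ξ`). So `ξ` is Killing and its flow preserves `φ`,
`η`, `g` and `g̃`. Therefore `L_ξ ḡ` differentiates only the scalar coefficients of `ḡ`. On `ker η`
these are the real and imaginary parts of `e^{2(u+iv)}`, whose derivative is multiplication by `2(du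
+ i dv)(ξ)`, with `i` acting through `φ`; this produces `ḡ` with coefficient `2du(ξ)` and the
associated metric of `ḡ` with coefficient `2dv(ξ)`, up to `η̄ ⊗ η̄` (`lieDerivative_gTransform`).
Passing from `ξ` to `k e^{-w} ξ` adds the symmetrization of `(dk - k dw) ⊗ η̄`. Splitting `dw(x) =
-dw(φ²x) + η̄(x) dw(ξ̄)` gives `h̄₁ + k h̄₂` and a multiple of `η̄ ⊗ η̄` that cancels the `dw(ξ̄)`
term above (`lieDerivative_gTransform_vertical`). Linearity of the Kulkarni–Nomizu product in its
second factor finishes the proof. -/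

theorem IsSmoothVectorField.mdifferentiableAt {X : Π p : M, TangentSpace I p}
    (hX : IsSmoothVectorField I X) (p : M) : MDiffAt (T% X) p :=
  (hX p).mdifferentiableAt (by simp)

theorem IsSmoothEndomorphism.apply {φ : Π p : M, TangentSpace I p →L[ℝ] TangentSpace I p}
    (hφ : IsSmoothEndomorphism I φ) {X : Π p : M, TangentSpace I p}
    (hX : IsSmoothVectorField I X) : IsSmoothVectorField I (fun p => φ p (X p)) :=
  ContMDiff.clm_bundle_apply hφ hX

/-- The chain rule for a function of one real variable. -/
theorem mvfderiv_comp_hasDerivAt {f : M → ℝ} {h : ℝ → ℝ} {h' : ℝ} {p : M}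
    (hh : HasDerivAt h h' (f p)) (hf : MDiffAt f p) (x : TangentSpace I p) :
    mvfderiv I (fun q => h (f q)) p x = h' * mvfderiv I f p x := by
  have h1 := mvfderiv_comp_apply p hh.differentiableAt.mdifferentiableAt hf x
  change mvfderiv I (h ∘ f) p x = _
  rw [h1]
  simp only [mvfderiv, mfderiv_eq_fderiv, hh.hasFDerivAt.fderiv]
  refine Eq.trans ?_ (mul_comm _ _)
  rfl

end SmoothTensors

/-! ### The Lie derivative of a pseudo-Riemannian metric. -/

section LieDerivative

variable {E : Type*} [NormedAddCommGroup E] [NormedSpace ℝ E]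
  {H : Type*} [TopologicalSpace H] {I : ModelWithCorners ℝ E H}
  {M : Type*} [TopologicalSpace M] [ChartedSpace H M] [IsManifold I ∞ M]
  [FiniteDimensional ℝ E] [CompleteSpace E]

/-- The extra terms come from `[fV, X] = f[V, X] - X(f) V`. They later supply `h̄₁`, `h̄₂` and a
multiple of `η̄ ⊗ η̄`. -/
theorem PseudoRiemannianMetric.lieDerivative_smul (g : PseudoRiemannianMetric I M) {f : M → ℝ}
    {V X Y : Π p : M, TangentSpace I p} {p : M} (hf : MDiffAt f p) (hV : MDiffAt (T% V) p) :
    g.lieDerivative (f • V) X Y p = f p * g.lieDerivative V X Y p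
      + mvfderiv I f p (X p) * g.val p (V p) (Y p)
      + mvfderiv I f p (Y p) * g.val p (X p) (V p) := by
  simp only [lieDerivative, mlieBracket_smul_left hf hV]
  simp
  ring

theorem PseudoRiemannianMetric.leviCivita_sub_leviCivita (g : PseudoRiemannianMetric I M)
    {X Y : Π p : M, TangentSpace I p} {p : M} (hX : MDiffAt (T% X) p) (hY : MDiffAt (T% Y) p) :
    g.leviCivita Y p (X p) - g.leviCivita X p (Y p) = mlieBracket I X Y p :=
  (CovariantDerivative.torsion_eq_zero_iff _).1 g.leviCivita_torsion hX hY

/-- Metric compatibility and vanishing torsion make the `∇_V` terms cancel. This reduces the Killing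
property of `ξ` to `∇ξ = 0`. -/
theorem PseudoRiemannianMetric.lieDerivative_eq_leviCivita (g : PseudoRiemannianMetric I M)
    {V X Y : Π p : M, TangentSpace I p} {p : M} (hV : MDiffAt (T% V) p) (hX : MDiffAt (T% X) p)
    (hY : MDiffAt (T% Y) p) :
    g.lieDerivative V X Y p =
      g.val p (g.leviCivita V p (X p)) (Y p) + g.val p (X p) (g.leviCivita V p (Y p)) := by
  rw [lieDerivative, g.leviCivita_metric hV hX hY, ← g.leviCivita_sub_leviCivita hV hX,
    ← g.leviCivita_sub_leviCivita hV hY]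
  simp

end LieDerivative

/-! ### Cosymplectic structures and the flow of the Reeb field. -/

section AccR

variable {n : ℕ} {M : Type*} [TopologicalSpace M]
  [ChartedSpace (EuclideanSpace ℝ (Fin (2 * n + 1))) M] [IsManifold (𝓡 (2 * n + 1)) ∞ M]

namespace AccRStructure

variable {A : AccRStructure n M} {X Y : Π p : M, TangentSpace (𝓡 (2 * n + 1)) p}

theorem smooth_phi (hX : IsSmoothVectorField (𝓡 (2 * n + 1)) X) :
    IsSmoothVectorField (𝓡 (2 * n + 1)) (A.phi X) :=
  A.smooth_φ.apply hX

theorem mdifferentiableAt_eta (hX : IsSmoothVectorField (𝓡 (2 * n + 1)) X) (p : M) :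
    MDifferentiableAt (𝓡 (2 * n + 1)) 𝓘(ℝ) (A.eta X) p := by
  have h : A.eta X = A.g.pair X A.ξ := funext fun q => (A.g_ξ q _).symm
  rw [h]
  exact A.g.mdifferentiableAt_pair (hX.mdifferentiableAt p) (A.smooth_ξ.mdifferentiableAt p)

namespace IsCosymplectic

/-- This is `∇φ = 0`, kept paired with a smooth test field: the class is defined in that form, and
later uses also occur inside `g`. -/
theorem leviCivita_phi (hA : A.IsCosymplectic) {Z : Π p : M, TangentSpace (𝓡 (2 * n + 1)) p}
    (hX : IsSmoothVectorField (𝓡 (2 * n + 1)) X) (hY : IsSmoothVectorField (𝓡 (2 * n + 1)) Y)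
    (hZ : IsSmoothVectorField (𝓡 (2 * n + 1)) Z) (p : M) :
    A.g.val p (A.g.leviCivita (A.phi Y) p (X p)) (Z p) =
      A.g.val p (A.φ p (A.g.leviCivita Y p (X p))) (Z p) := by
  have h := congrFun (hA X Y Z hX hY hZ) p
  simpa [F, sub_eq_zero] using h

/-- On a cosymplectic manifold the Reeb vector field is parallel. -/
theorem leviCivita_ξ (hA : A.IsCosymplectic)
    (hX : IsSmoothVectorField (𝓡 (2 * n + 1)) X) (hY : IsSmoothVectorField (𝓡 (2 * n + 1)) Y)
    (p : M) : A.g.val p (A.g.leviCivita A.ξ p (X p)) (Y p) = 0 := by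
  have hξ := A.smooth_ξ.mdifferentiableAt p
  -- Testing against `φY` turns `g(φ∇_Xξ, φY)` into `-g(∇_Xξ, Y) + η(∇_Xξ) η(Y)`, while the other
  -- side vanishes because `φξ = 0`.
  have h1 := hA.leviCivita_phi hX A.smooth_ξ (smooth_phi (A := A) hY) p
  have h0 : A.phi A.ξ = 0 := funext fun q => A.φ_ξ q
  -- The length of `ξ` is constant, so `∇_X ξ` has no `η`-component.
  have h2 := A.g.leviCivita_metric (hX.mdifferentiableAt p) hξ hξ
  have h3 : A.g.pair A.ξ A.ξ = fun _ => 1 := funext fun q => by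
    simp [PseudoRiemannianMetric.pair, A.g_ξ, A.η_ξ]
  rw [h3, mvfderiv_const, A.g.symm p (A.ξ p), A.g_ξ] at h2
  have h4 : A.g.leviCivita (0 : Π p : M, TangentSpace (𝓡 (2 * n + 1)) p) p = 0 := by
    simp
  rw [h0, h4, phi, A.g_φ_φ] at h1
  simp only [zero_apply, map_zero] at h1 h2
  have h5 : A.η p (A.g.leviCivita A.ξ p (X p)) = 0 := by linarith
  rw [h5] at h1
  linarith

/-- On a cosymplectic manifold the Reeb vector field is Killing. -/
theorem lieDerivative_ξ (hA : A.IsCosymplectic)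
    (hX : IsSmoothVectorField (𝓡 (2 * n + 1)) X) (hY : IsSmoothVectorField (𝓡 (2 * n + 1)) Y)
    (p : M) : A.g.lieDerivative A.ξ X Y p = 0 := by
  rw [A.g.lieDerivative_eq_leviCivita (A.smooth_ξ.mdifferentiableAt p) (hX.mdifferentiableAt p)
    (hY.mdifferentiableAt p), hA.leviCivita_ξ hX hY, A.g.symm, hA.leviCivita_ξ hY hX, add_zero]

/-- On a cosymplectic manifold the Reeb flow preserves `φ`. -/
theorem mlieBracket_ξ_phi (hA : A.IsCosymplectic)
    (hX : IsSmoothVectorField (𝓡 (2 * n + 1)) X) (hY : IsSmoothVectorField (𝓡 (2 * n + 1)) Y)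
    (p : M) :
    A.g.val p (mlieBracket (𝓡 (2 * n + 1)) A.ξ (A.phi X) p) (Y p) =
      A.g.val p (mlieBracket (𝓡 (2 * n + 1)) A.ξ X p) (A.φ p (Y p)) := by
  have hξ := A.smooth_ξ.mdifferentiableAt p
  -- Since `∇ξ = 0`, the bracket `[ξ, X]` is `∇_ξ X`, and `∇_ξ` commutes with `φ`.
  rw [← A.g.leviCivita_sub_leviCivita hξ ((smooth_phi hX).mdifferentiableAt p),
    ← A.g.leviCivita_sub_leviCivita hξ (hX.mdifferentiableAt p)]
  have h1 := hA.leviCivita_ξ hX (smooth_phi (A := A) hY) p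
  rw [phi] at h1
  simp only [map_sub, sub_apply]
  rw [hA.leviCivita_phi A.smooth_ξ hX hY, hA.leviCivita_ξ (smooth_phi hX) hY, h1, A.g_φ_left]

/-- The Killing equation as a Leibniz rule: it trades derivatives of `g(X, Y)` along `ξ` for
brackets, which then cancel in `L_ξ ḡ`. -/
theorem mvfderiv_pair_ξ (hA : A.IsCosymplectic)
    (hX : IsSmoothVectorField (𝓡 (2 * n + 1)) X) (hY : IsSmoothVectorField (𝓡 (2 * n + 1)) Y)
    (p : M) :
    mvfderiv (𝓡 (2 * n + 1)) (A.g.pair X Y) p (A.ξ p) =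
      A.g.val p (mlieBracket (𝓡 (2 * n + 1)) A.ξ X p) (Y p)
        + A.g.val p (X p) (mlieBracket (𝓡 (2 * n + 1)) A.ξ Y p) := by
  have h := hA.lieDerivative_ξ hX hY p
  rw [PseudoRiemannianMetric.lieDerivative] at h
  linarith

/-- This says `L_ξ η = 0`: `η` is dual to `ξ` under `g`, which the flow preserves, and `[ξ, ξ] = 0`.
-/
theorem mvfderiv_eta_ξ (hA : A.IsCosymplectic)
    (hX : IsSmoothVectorField (𝓡 (2 * n + 1)) X) (p : M) :
    mvfderiv (𝓡 (2 * n + 1)) (A.eta X) p (A.ξ p) =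
      A.η p (mlieBracket (𝓡 (2 * n + 1)) A.ξ X p) := by
  have h : A.eta X = A.g.pair X A.ξ := funext fun q => (A.g_ξ q _).symm
  rw [h, hA.mvfderiv_pair_ξ hX A.smooth_ξ, mlieBracket_self, A.g_ξ]
  simp

end IsCosymplectic

/-! ### Lie derivatives of the transformed metric. -/

variable (u v w : C^∞⟮𝓡 (2 * n + 1), M; ℝ⟯)

theorem mdifferentiableAt_contMDiffMap (f : C^∞⟮𝓡 (2 * n + 1), M; ℝ⟯) (p : M) : MDifferentiableAt (𝓡 (2 * n + 1)) 𝓘(ℝ) ⇑f p :=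
  (f.contMDiff p).mdifferentiableAt (by simp)

/-- The `η ⊗ η` summand hidden in `g̃` cancels the `sin` part of the last coefficient, so only the
`cos` part remains there. -/
theorem gTransform_val (p : M) (x y : TangentSpace (𝓡 (2 * n + 1)) p) :
    (A.gTransform u v w).g.val p x y =
      Real.exp (2 * u p) * Real.cos (2 * v p) * A.g.val p x y
        + Real.exp (2 * u p) * Real.sin (2 * v p) * A.g.val p (A.φ p x) y
        + (Real.exp (2 * w p) - Real.exp (2 * u p) * Real.cos (2 * v p))
          * (A.η p x * A.η p y) := by
  change Real.exp (2 * u p) * Real.cos (2 * v p) * A.g.val p x y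
    + Real.exp (2 * u p) * Real.sin (2 * v p) * A.associated p x y
    + (Real.exp (2 * w p) - Real.exp (2 * u p) * Real.cos (2 * v p)
        - Real.exp (2 * u p) * Real.sin (2 * v p)) * (A.η p x * A.η p y) = _
  rw [associated_apply, A.g_φ_left]
  ring

/-- As `ξ` preserves `g`, `φ` and `η`, only the coefficients of `ḡ` contribute. The `dv` part
rotates `g` into `g(φ·, ·)`, which is what `g̃` of the transformed structure measures on `ker η`. -/
theorem lieDerivative_gTransform (hA : A.IsCosymplectic)
    (hX : IsSmoothVectorField (𝓡 (2 * n + 1)) X) (hY : IsSmoothVectorField (𝓡 (2 * n + 1)) Y)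
    (p : M) :
    (A.gTransform u v w).g.lieDerivative A.ξ X Y p =
      2 * (derivAlong u A.ξ p * (A.gTransform u v w).g.pair X Y p
        + derivAlong v A.ξ p * (A.gTransform u v w).gTilde X Y p
        + (derivAlong w A.ξ p - derivAlong u A.ξ p - derivAlong v A.ξ p)
          * (A.gTransform u v w).etaSq X Y p) := by
  have hexp (f : C^∞⟮𝓡 (2 * n + 1), M; ℝ⟯) : HasDerivAt (fun t : ℝ => Real.exp (2 * t))
      (2 * Real.exp (2 * f p)) (f p) := by
    simpa [mul_comm] using ((hasDerivAt_id (f p)).const_mul 2).exp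
  have hcos : HasDerivAt (fun t : ℝ => Real.cos (2 * t)) (-(2 * Real.sin (2 * v p))) (v p) := by
    simpa [mul_comm] using ((hasDerivAt_id (v p)).const_mul 2).cos
  have hsin : HasDerivAt (fun t : ℝ => Real.sin (2 * t)) (2 * Real.cos (2 * v p)) (v p) := by
    simpa [mul_comm] using ((hasDerivAt_id (v p)).const_mul 2).sin
  have mu := mdifferentiableAt_contMDiffMap u p
  have mv := mdifferentiableAt_contMDiffMap v p
  have mw := mdifferentiableAt_contMDiffMap w p
  have du := mvfderiv_comp_hasDerivAt (hexp u) mu (A.ξ p)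
  have dw := mvfderiv_comp_hasDerivAt (hexp w) mw (A.ξ p)
  have dc := mvfderiv_comp_hasDerivAt hcos mv (A.ξ p)
  have ds := mvfderiv_comp_hasDerivAt hsin mv (A.ξ p)
  have me (f : C^∞⟮𝓡 (2 * n + 1), M; ℝ⟯) : MDifferentiableAt (𝓡 (2 * n + 1)) 𝓘(ℝ) (fun q => Real.exp (2 * f q)) p :=
    (hexp f).differentiableAt.mdifferentiableAt.comp p (mdifferentiableAt_contMDiffMap f p)
  have mc : MDifferentiableAt (𝓡 (2 * n + 1)) 𝓘(ℝ) (fun q => Real.cos (2 * v q)) p :=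
    hcos.differentiableAt.mdifferentiableAt.comp p mv
  have ms : MDifferentiableAt (𝓡 (2 * n + 1)) 𝓘(ℝ) (fun q => Real.sin (2 * v q)) p :=
    hsin.differentiableAt.mdifferentiableAt.comp p mv
  have hφX := smooth_phi (A := A) hX
  have m1 := A.g.mdifferentiableAt_pair (hX.mdifferentiableAt p) (hY.mdifferentiableAt p)
  have m2 := A.g.mdifferentiableAt_pair (hφX.mdifferentiableAt p) (hY.mdifferentiableAt p)
  have m3 := mdifferentiableAt_eta (A := A) hX p
  have m4 := mdifferentiableAt_eta (A := A) hY p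
  have hpair : (A.gTransform u v w).g.pair X Y =
      ((fun q => Real.exp (2 * u q)) * fun q => Real.cos (2 * v q)) * A.g.pair X Y
        + ((fun q => Real.exp (2 * u q)) * fun q => Real.sin (2 * v q)) * A.g.pair (A.phi X) Y
        + ((fun q => Real.exp (2 * w q))
            - (fun q => Real.exp (2 * u q)) * fun q => Real.cos (2 * v q))
          * (A.eta X * A.eta Y) :=
    funext fun q => gTransform_val u v w q _ _
  have e1 := congrArg (fun f => mvfderiv (𝓡 (2 * n + 1)) f p (A.ξ p)) hpair
  beta_reduce at e1
  rw [mvfderiv_add ((((me u).mul mc).mul m1).add (((me u).mul ms).mul m2))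
      (((me w).sub ((me u).mul mc)).mul (m3.mul m4)),
    mvfderiv_add (((me u).mul mc).mul m1) (((me u).mul ms).mul m2),
    mvfderiv_mul ((me u).mul mc) m1, mvfderiv_mul ((me u).mul ms) m2,
    mvfderiv_mul ((me w).sub ((me u).mul mc)) (m3.mul m4), mvfderiv_mul m3 m4,
    mvfderiv_sub (me w) ((me u).mul mc), mvfderiv_mul (me u) mc, mvfderiv_mul (me u) ms] at e1
  have e2 := hA.mvfderiv_pair_ξ hX hY p
  have e3 := hA.mvfderiv_pair_ξ hφX hY p
  have e4 := hA.mvfderiv_eta_ξ hX p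
  have e5 := hA.mvfderiv_eta_ξ hY p
  -- Moving `φ` off the bracket leaves only `[ξ, X]` and `[ξ, Y]`, the brackets present in `L_ξ ḡ`.
  rw [hA.mlieBracket_ξ_phi hX hY] at e3
  simp only [add_apply, sub_apply, smul_apply, smul_eq_mul, Pi.mul_apply, Pi.sub_apply,
    du, dw, dc, ds, e2, e3, e4, e5] at e1
  have hw : Real.exp (w p) * Real.exp (w p) = Real.exp (2 * w p) := by
    rw [← Real.exp_add, two_mul (w p)]
  have hη (x : TangentSpace (𝓡 (2 * n + 1)) p) :
      (A.gTransform u v w).η p x = Real.exp (w p) * A.η p x := by simp [gTransform]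
  rw [PseudoRiemannianMetric.lieDerivative, e1]
  simp only [derivAlong, gTilde, etaSq, eta, associated_apply, PseudoRiemannianMetric.pair,
    Pi.mul_apply, hη, gTransform_val, phi]
  rw [show (A.gTransform u v w).φ = A.φ from rfl]
  simp only [A.g_φ_left, A.φ_φ, A.η_φ, map_add, map_neg, map_smul, smul_eq_mul, A.g_ξ]
  -- `η̄ ⊗ η̄` brings `e^w e^w`, whereas `ḡ` contains `e^{2w}`. The `dv` contributions of `η̄ ⊗ η̄`
  -- cancel, so only `dw` and `du` appear as coefficients.
  linear_combination (-2 * mvfderiv (𝓡 (2 * n + 1)) ⇑w p (A.ξ p) * A.η p (X p) * A.η p (Y p)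
    + 2 * mvfderiv (𝓡 (2 * n + 1)) ⇑u p (A.ξ p) * A.η p (X p) * A.η p (Y p)) * hw

/-- The Lie derivative of the transformed metric along a vertical vector field. -/
theorem lieDerivative_gTransform_vertical (hA : A.IsCosymplectic) {B : AccRStructure n M}
    (hB : B = A.gTransform u v w) (k : C^∞⟮𝓡 (2 * n + 1), M; ℝ⟯)
    (hX : IsSmoothVectorField (𝓡 (2 * n + 1)) X) (hY : IsSmoothVectorField (𝓡 (2 * n + 1)) Y)
    (p : M) :
    B.g.lieDerivative (fun p => k p • B.ξ p) X Y p =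
      2 * k p * (derivAlong u B.ξ p * B.g.pair X Y p + derivAlong v B.ξ p * B.gTilde X Y p
        - (derivAlong u B.ξ p + derivAlong v B.ξ p) * B.etaSq X Y p)
      + B.hOne k X Y p + k p * B.hTwo w X Y p := by
  have hexp : HasDerivAt (fun t : ℝ => Real.exp (-t)) (-Real.exp (-w p)) (w p) := by
    simpa using (hasDerivAt_neg (w p)).exp
  have mw := mdifferentiableAt_contMDiffMap w p
  have mk := mdifferentiableAt_contMDiffMap k p
  have me : MDifferentiableAt (𝓡 (2 * n + 1)) 𝓘(ℝ) (fun q => Real.exp (-w q)) p :=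
    hexp.differentiableAt.mdifferentiableAt.comp p mw
  have hV : (fun p => k p • B.ξ p) = (⇑k * fun q => Real.exp (-w q)) • A.ξ := by
    subst hB
    exact funext fun q => smul_smul _ _ _
  have hw : Real.exp (w p) * Real.exp (-w p) = 1 := by rw [← Real.exp_add]; simp
  have hξ : B.ξ p = Real.exp (-w p) • A.ξ p := by subst hB; rfl
  -- Writing `ξ` through `ξ̄` expresses every derivative and contraction in the barred structure, at
  -- the price of factors `e^w e^{-w}`.
  have hξ' : A.ξ p = Real.exp (w p) • B.ξ p := by rw [hξ, smul_smul, hw, one_smul]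
  have hd := lieDerivative_gTransform u v w hA hX hY p
  rw [← hB] at hd
  have hsymm := B.g.symm p (B.ξ p) (Y p)
  rw [hV, B.g.lieDerivative_smul (mk.mul me) (A.smooth_ξ.mdifferentiableAt p), hd,
    mvfderiv_mul mk me]
  simp only [add_apply, smul_apply, smul_eq_mul, Pi.mul_apply,
    mvfderiv_comp_hasDerivAt hexp mw, derivAlong, hOne, hTwo, Pi.add_apply, etaSq, eta, phi,
    hξ', map_smul, B.g_ξ, B.φ_φ, hsymm, map_add, map_neg]
  -- The coefficient of `e^w e^{-w} = 1` collects `k L_{ξ̄}`-type terms and `(dk - k dw) ⊗ η̄`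
  -- symmetrized. The terms `dw(ξ̄) η̄ ⊗ η̄` from the former cancel against those from `φ²` in
  -- `hTwo`.
  linear_combination (2 * k p * (mvfderiv (𝓡 (2 * n + 1)) ⇑u p (B.ξ p) * B.g.pair X Y p
      + mvfderiv (𝓡 (2 * n + 1)) ⇑v p (B.ξ p) * B.gTilde X Y p
      + (mvfderiv (𝓡 (2 * n + 1)) ⇑w p (B.ξ p) - mvfderiv (𝓡 (2 * n + 1)) ⇑u p (B.ξ p)
        - mvfderiv (𝓡 (2 * n + 1)) ⇑v p (B.ξ p)) * B.η p (X p) * B.η p (Y p))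
    + (mvfderiv (𝓡 (2 * n + 1)) ⇑k p (X p) - k p * mvfderiv (𝓡 (2 * n + 1)) ⇑w p (X p))
      * B.η p (Y p)
    + (mvfderiv (𝓡 (2 * n + 1)) ⇑k p (Y p) - k p * mvfderiv (𝓡 (2 * n + 1)) ⇑w p (Y p))
      * B.η p (X p)) * hw

end AccRStructure

end AccR

/-! ### Solving the soliton equation for the curvature. -/

theorem mainTheorem2 {n : ℕ} {M : Type*} [TopologicalSpace M] [T2Space M]
    [ChartedSpace (EuclideanSpace ℝ (Fin (2 * n + 1))) M] [IsManifold (𝓡 (2 * n + 1)) ∞ M]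
    (A : AccRStructure n M) (hA : A.IsCosymplectic)
    (u v w : C^∞⟮𝓡 (2 * n + 1), M; ℝ⟯)
    (B : AccRStructure n M) (hB : B = A.gTransform u v w)
    (σ k : C^∞⟮𝓡 (2 * n + 1), M; ℝ⟯)
    (hsol : IsAlmostRiemannSoliton B.g (fun p => k p • B.ξ p) σ)
    (X Y Z W : Π p : M, TangentSpace (𝓡 (2 * n + 1)) p)
    (hX : IsSmoothVectorField (𝓡 (2 * n + 1)) X) (hY : IsSmoothVectorField (𝓡 (2 * n + 1)) Y)
    (hZ : IsSmoothVectorField (𝓡 (2 * n + 1)) Z) (hW : IsSmoothVectorField (𝓡 (2 * n + 1)) W) :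
    B.g.curvature4 X Y Z W =
      -((1 / 2 : ℝ) • ⇑σ + k * derivAlong u B.ξ) * kulkarniNomizu B.g.pair B.g.pair X Y Z W
      - k * (derivAlong v B.ξ * kulkarniNomizu B.g.pair B.gTilde X Y Z W
          - (derivAlong u B.ξ + derivAlong v B.ξ) * kulkarniNomizu B.g.pair B.etaSq X Y Z W)
      - (1 / 2 : ℝ) • kulkarniNomizu B.g.pair (B.hOne k) X Y Z W
      - (1 / 2 : ℝ) • (k * kulkarniNomizu B.g.pair (B.hTwo w) X Y Z W) := by
  subst hB
  have key := fun X Y hX hY p =>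
    AccRStructure.lieDerivative_gTransform_vertical (X := X) (Y := Y) u v w hA rfl k hX hY p
  ext p
  have h := congrFun (hsol.equation X Y Z W hX hY hZ hW) p
  -- The Lie derivative enters the product only on the pairs `(X, W)`, `(Y, W)`, `(Y, Z)` and `(X,
  -- Z)`; after substitution the claim is half the soliton equation.
  simp only [kulkarniNomizu, Pi.add_apply, Pi.sub_apply, Pi.mul_apply, Pi.neg_apply,
    Pi.smul_apply, smul_eq_mul, Pi.ofNat_apply, key _ _ hX hW, key _ _ hY hW,
    key _ _ hY hZ, key _ _ hX hZ] at h ⊢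
  linear_combination h / 2
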